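/- Let $b\ge 2$ be an integer and $c>1$ a real number. For $H\ge 0$ let $T$ be the complete tree of height $H$ in which every non-leaf node has exactly $b$ children, and let $n=b^H$ be the number of its leaves. For leaves $u,v$ let $h(u,v)$ be the height of the smallest subtree of $T$ containing both $u$ and $v$. The directed community-guided attachment (CGA) model is the random directed graph $G$ whose vertices are the leaves of $T$, in which, independently for all ordered pairs $(u,v)$ of leaves, the edge from $u$ to $v$ is present with probability $c^{-h(u,v)}$ (so every vertex carries a loop, as $h(u,u)=0$). For a vertex $v$ and a vertex set $M$ let $e_d(v,M)$ be the number of edges from $v$ to $M$. A directed $(\alpha,\beta)$-cluster is a vertex set $M$ such that $e_d(v,M)\ge\beta|M|$ for all $v\in M$ and $e_d(u,M)\le\alpha|M|$ for all $u\notin M$. The height of $M$ is the height of the smallest complete subtree of $T$ containing $M$, and a set of height $h$ is called complete if it has $b^h$ vertices. An event holds a.a.s. if its probability tends to $1$ as $n=b^H\to\infty$. Theorem. Let $0<\alpha\le 1$ and $m^\star=\frac{\ln b}{\alpha\ln c}$. There is a constant $\gamma=\gamma(\alpha,b,c)>0$ such that for all $0<\beta\le1$ and all $\epsilon>0$ the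 following hold. (a) A.a.s. $G$ has a directed $(\alpha,\beta)$-cluster with more than $(\ln n)^{\frac12-\epsilon}$ vertices. Moreover, for each integer $h\geq 0$ (constant, or a function of $n$) that satisfies $\log_b m^\star<h\le\left(\frac12-\epsilon\right)\frac{\ln\ln n}{\ln b}$ for all large $n$, a.a.s. $G$ has at least $(\ln n)^{\gamma b^h}$ complete directed $(\alpha,\beta)$-clusters of size $b^h$. (b) A.a.s. $G$ has no directed $(\alpha,\beta)$-cluster with more than $(\ln n)^{\frac12+\epsilon}$ vertices. -/

import Mathlib

namespace CGA

/-- The leaves of the complete tree of height `H` with fan-out `b`. A leaf is given by the branches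
taken on the way from the root down to it: `u i` is the branch taken from its ancestor at
height `i + 1` to its ancestor at height `i`. There are `b ^ H` leaves. -/
abbrev Leaf (b H : ℕ) : Type := Fin H → Fin b

/-- The complete set of height `k` containing the leaf `a`: the leaves of the subtree rooted at the
ancestor of `a` at height `k`, that is, the leaves that share with `a` every branch taken
above height `k`. (For `k ≥ H` these are all leaves.) -/
def subtree {b H : ℕ} (a : Leaf b H) (k : ℕ) : Set (Leaf b H) :=
  {u | ∀ i : Fin H, k ≤ (i : ℕ) → u i = a i}

/-- `h(u, v)`: the height of the smallest subtree that contains both `u` and `v`. -/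
noncomputable def leafHeight {b H : ℕ} (u v : Leaf b H) : ℕ :=
  sInf {k : ℕ | ∃ a : Leaf b H, u ∈ subtree a k ∧ v ∈ subtree a k}

/-- The height of a set of leaves: the height of the smallest complete subtree containing it. -/
noncomputable def setHeight {b H : ℕ} (M : Finset (Leaf b H)) : ℕ :=
  sInf {k : ℕ | ∃ a : Leaf b H, ∀ u ∈ M, u ∈ subtree a k}

/-- A set of height `h` is complete if it has `b ^ h` elements. -/
def IsComplete {b H : ℕ} (M : Finset (Leaf b H)) : Prop :=
  M.card = b ^ setHeight M

/-- The edge probability `c ^ (-k)` of an ordered pair of leaves `(u, v)` with `h(u, v) = k`. -/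
noncomputable def edgeProb (c : ℝ) (hc : 1 < c) (k : ℕ) : unitInterval :=
  ⟨(c ^ k)⁻¹, inv_nonneg.2 (pow_nonneg (zero_le_one.trans hc.le) k),
    inv_le_one_of_one_le₀ (one_le_pow₀ hc.le)⟩

/-- The law of the edge indicators of the directed CGA model: independently for every ordered pair
`(u, v)` of leaves, the edge from `u` to `v` is present with probability `c ^ (-h(u, v))`.
(For `u = v` this probability is `c ^ 0 = 1`: every vertex carries a loop.) -/
noncomputable def edgeLaw (b : ℕ) (c : ℝ) (hc : 1 < c) (H : ℕ) :
    MeasureTheory.Measure (Leaf b H × Leaf b H → Bool) :=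
  MeasureTheory.Measure.pi fun e =>
    ProbabilityTheory.bernoulliMeasure true false (edgeProb c hc (leafHeight e.1 e.2))

/-- The directed graph with given edge indicators. -/
def toDigraph {V : Type*} (ω : V × V → Bool) : Digraph V where
  Adj u v := ω (u, v) = true

/-- The property `P` of directed graphs on the leaves holds asymptotically almost surely in the
directed CGA model with parameters `b` and `c`: its probability tends to one as the number
`n = b ^ H` of vertices tends to infinity. -/
def AAS (b : ℕ) (c : ℝ) (hc : 1 < c) (P : (H : ℕ) → Digraph (Leaf b H) → Prop) : Prop :=
  Filter.Tendsto (fun H : ℕ => edgeLaw b c hc H {ω | P H (toDigraph ω)}) Filter.atTop (nhds 1)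

open Classical in
/-- `e_d(v, M)`: the number of edges from `v` to `M`. -/
noncomputable def outDegreeInto {V : Type*} (G : Digraph V) (v : V) (M : Finset V) : ℕ :=
  (M.filter fun u => G.Adj v u).card

/-- Every vertex of `M` has at least `β |M|` edges to `M`. -/
def IsInternallyDense {V : Type*} (G : Digraph V) (β : ℝ) (M : Finset V) : Prop :=
  ∀ v ∈ M, β * (M.card : ℝ) ≤ (outDegreeInto G v M : ℝ)

/-- Every vertex outside `M` has at most `α |M|` edges to `M`. -/
def IsExternallySparse {V : Type*} (G : Digraph V) (α : ℝ) (M : Finset V) : Prop :=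
  ∀ u, u ∉ M → (outDegreeInto G u M : ℝ) ≤ α * (M.card : ℝ)

/-- `M` is a directed `(α, β)`-cluster of `G`. -/
def IsCluster {V : Type*} (G : Digraph V) (α β : ℝ) (M : Finset V) : Prop :=
  IsInternallyDense G β M ∧ IsExternallySparse G α M

/-- The number of complete directed `(α, β)`-clusters of size `b ^ h`. -/
noncomputable def numCompleteClusters {b H : ℕ} (G : Digraph (Leaf b H)) (α β : ℝ) (h : ℕ) : ℕ :=
  Set.ncard {M : Finset (Leaf b H) | IsCluster G α β M ∧ IsComplete M ∧ M.card = b ^ h}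

/-- `ln n`, where `n = b ^ H` is the number of vertices. -/
noncomputable def lnN (b H : ℕ) : ℝ := Real.log ((b ^ H : ℕ) : ℝ)

end CGA

/-!
Directed `(α, β)`-clusters in the CGA model: complete clusters exist up to size
`(log n) ^ (1 / 2 - ε)`, and no cluster exceeds `(log n) ^ (1 / 2 + ε)`. Write `L = log n`.

**Lower bound.** Let `M` be a complete set of height `h`, of size `B = b ^ h`. It is a cluster if all
edges inside `M` are present and no outside vertex has more than `α B` edges to `M`. The first costs
a probability of at least `c ^ (-h B ^ 2)`. For the second, a vertex at height `k` over `M` fails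
with probability at most `2 ^ B * c ^ (-k α B)`, while there are at most `b ^ k` of them; since
`c ^ (α B) > b` exactly when `B > log b / (α log c)`, these probabilities have a sum of at most
`1 / 2` beyond some constant height `d` (`exists_height_sum_le`), and the at most `b ^ d` vertices
below that height are made to send no edge to `M` at all. Edges with different sources are
independent, so `M` is a cluster with probability `exp (-O (h B ^ 2))`
(`le_measureReal_isCluster`), which is `n ^ (-o (1))` for `B ≤ L ^ (1 / 2 - ε)`. Whether `M` is a
cluster is decided by the edges into `M`, so these events are independent for the `b ^ (H - h)`
complete sets of height `h`, and Chebyshev's inequality gives `n ^ (1 - o (1))` clusters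
(`aas_numCompleteClusters`). This is far more than `L ^ (γ B)` for every constant `γ`; the theorem
is proved with `γ = 1`.

**Upper bound.** Internal density alone is responsible. Let `M` be internally dense, `|M| = m`, so
that it has at least `β m ^ 2` edges. Either half of them join leaves of height at least `m`. This
has probability at most `2 ^ (m ^ 2) * c ^ (-β m ^ 3 / 2)`, and for `m ≥ L ^ (1 / 2 + ε)` the cubic
exponent beats the `n ^ m` choices of `M` (`measureReal_manyLongEdges_le_exp`). Or half of them
lie within the subtrees of height `m`, and then, by averaging, `M` meets one of those in a set `S`
with at least `(β / 2) m |S|` edges. Then `s = |S|` is at least `β m / 2`, so that `S` is one of the at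
most `n * b ^ (O (s ^ 2))` sets of size `s` and height `O (s)`; at least half of its
edges have a height above any given constant, which makes the probability `exp (-C s ^ 2)` with `C`
as large as needed (`measureReal_lowDenseSet_le_exp`).
-/

namespace CGA

open MeasureTheory ProbabilityTheory Filter


/-! ### Independence in a finite product of coin flips -/

section ProductMeasure

variable {E : Type*} [Fintype E] {ν : E → Measure Bool} [∀ e, IsProbabilityMeasure (ν e)]

/-- Two functions of the edge indicators are independent if they look at disjoint sets of edges. -/
theorem indepFun_of_dependsOn {β γ : Type*} [MeasurableSpace β] [MeasurableSpace γ]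
    [Nonempty β] [Nonempty γ] {f : (E → Bool) → β} {g : (E → Bool) → γ} {S T : Finset E}
    (hf : DependsOn f S) (hg : DependsOn g T) (hST : Disjoint S T) :
    IndepFun f g (Measure.pi ν) := by
  obtain ⟨f', rfl⟩ := (dependsOn_iff_exists_comp).1 hf
  obtain ⟨g', rfl⟩ := (dependsOn_iff_exists_comp).1 hg
  have h := (iIndepFun_pi (μ := ν) (X := fun _ x => x) fun _ => aemeasurable_id).indepFun_finset
    S T hST fun e => measurable_pi_apply e
  exact h.comp (φ := f') (ψ := g') (Measurable.of_discrete) (Measurable.of_discrete)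

theorem measureReal_inter_of_dependsOn {A B : Set (E → Bool)} {S T : Finset E}
    (hA : DependsOn (· ∈ A) (S : Set E)) (hB : DependsOn (· ∈ B) (T : Set E))
    (hST : Disjoint S T) :
    (Measure.pi ν).real (A ∩ B) = (Measure.pi ν).real A * (Measure.pi ν).real B := by
  have h := (indepFun_of_dependsOn (ν := ν) hA hB hST).measure_inter_preimage_eq_mul {True} {True}
    (by trivial) (by trivial)
  have e (C : Set (E → Bool)) : (fun x => x ∈ C) ⁻¹' {True} = C := by ext; simp
  rw [e, e] at h
  simp [measureReal_def, h]

/-- Events that look at the different fibers of a map `g` are independent. -/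
theorem measureReal_biInter_of_dependsOn {κ : Type*} [DecidableEq κ] (g : E → κ)
    {A : κ → Set (E → Bool)} (hA : ∀ k, DependsOn (· ∈ A k) {e | g e = k}) (s : Finset κ) :
    (Measure.pi ν).real (⋂ k ∈ s, A k) = ∏ k ∈ s, (Measure.pi ν).real (A k) := by
  classical
  induction s using Finset.induction_on with
  | empty => simp
  | insert k s hk ih =>
    rw [Finset.prod_insert hk, ← ih, Finset.set_biInter_insert]
    refine measureReal_inter_of_dependsOn (S := Finset.univ.filter fun e => g e = k)
      (T := Finset.univ.filter fun e => g e ∈ s) (by simpa using hA k) ?_ ?_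
    · intro x y hxy
      have : ∀ k ∈ s, (x ∈ A k) = (y ∈ A k) := fun k hk => hA k fun e he => hxy e (by
        simp only [Set.mem_ofPred_eq] at he; simp [he, hk])
      simp only [Set.mem_iInter, eq_iff_iff]
      exact forall₂_congr fun k hk => by rw [this k hk]
    · rw [Finset.disjoint_filter]
      rintro e - rfl
      exact hk

/-- Chebyshev's inequality for a number of independent events: if each of them has probability at
least `p`, then it is unlikely that at most half of the expected number of them occur. -/
theorem measureReal_card_le {κ : Type*} [Fintype κ] [DecidableEq κ] (g : E → κ)
    {A : κ → Set (E → Bool)} (hA : ∀ k, DependsOn (· ∈ A k) {e | g e = k}) {p : ℝ} (hp : 0 < p)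
    (hpA : ∀ k, p ≤ (Measure.pi ν).real (A k)) (hκ : 0 < Fintype.card κ) :
    (Measure.pi ν).real {ω | 2 * (Nat.card {k // ω ∈ A k} : ℝ) ≤ Fintype.card κ * p} ≤
      4 / (Fintype.card κ * p) := by
  classical
  set μ := Measure.pi ν with hμ
  let X : κ → (E → Bool) → ℝ := fun k => (A k).indicator 1
  have hX (k) : MemLp (X k) 2 μ := (MemLp.of_discrete)
  have hS (ω) : (Nat.card {k // ω ∈ A k} : ℝ) = (∑ k, X k) ω := by
    rw [Nat.card_eq_fintype_card, Fintype.card_subtype, Finset.card_eq_sum_ones, Finset.sum_filter]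
    simp [X, Set.indicator_apply]
  have hint (k) : ∫ ω, X k ω ∂μ = μ.real (A k) :=
    integral_indicator_one (.of_discrete)
  set s : ℝ := ∑ k, μ.real (A k) with hs
  have hmean : ∫ ω, (∑ k, X k) ω ∂μ = s := by
    simp only [Finset.sum_apply]
    rw [integral_finsetSum _ fun k _ => (hX k).integrable (by norm_num)]
    simp [hint, hs]
  have hNp : Fintype.card κ * p ≤ s := by
    simpa using Finset.sum_le_sum fun k (_ : k ∈ Finset.univ) => hpA k
  have hNp0 : 0 < Fintype.card κ * p := by positivity
  have hs0 : 0 < s := hNp0.trans_le hNp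
  have hvar : variance (∑ k, X k) μ ≤ s := by
    rw [IndepFun.variance_sum (fun k _ => hX k)]
    · refine Finset.sum_le_sum fun k _ => ?_
      refine (variance_le_expectation_sq (hX k).1).trans_eq ?_
      rw [← hint]
      congr 1
      ext ω
      by_cases h : ω ∈ A k <;> simp [X, h]
    · intro k _ l _ hkl
      have hd (k) : DependsOn (X k) (Finset.univ.filter fun e => g e = k : Finset E) := by
        intro x y hxy
        have : (x ∈ A k) = (y ∈ A k) := hA k fun e he => hxy e (by simpa using he)
        simp only [X, Set.indicator_apply, this, Pi.one_apply]
      refine indepFun_of_dependsOn (hd k) (hd l) ?_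
      rw [Finset.disjoint_filter]
      rintro e - rfl
      exact hkl
  have hcheb := meas_ge_le_variance_div_sq (μ := μ) (X := ∑ k, X k)
    (memLp_finsetSum' _ fun k _ => hX k) (c := s / 2) (by positivity)
  rw [hmean] at hcheb
  calc μ.real {ω | 2 * (Nat.card {k // ω ∈ A k} : ℝ) ≤ Fintype.card κ * p}
      ≤ μ.real {ω | s / 2 ≤ |(∑ k, X k) ω - s|} := by
        refine measureReal_mono fun ω hω => ?_
        simp only [Set.mem_ofPred_eq] at hω ⊢
        rw [hS] at hω
        rw [abs_sub_comm]
        exact le_trans (by linarith) (le_abs_self _)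
    _ ≤ variance (∑ k, X k) μ / (s / 2) ^ 2 :=
        ENNReal.toReal_le_of_le_ofReal (div_nonneg (variance_nonneg _ _) (by positivity)) hcheb
    _ ≤ s / (s / 2) ^ 2 := by gcongr
    _ = 4 / s := by field_simp; norm_num
    _ ≤ _ := by gcongr

end ProductMeasure

/-- Weierstrass' product inequality. -/
theorem one_sub_sum_le_prod {κ : Type*} (s : Finset κ) (q : κ → ℝ) (h0 : ∀ k ∈ s, 0 ≤ q k)
    (h1 : ∀ k ∈ s, q k ≤ 1) : 1 - ∑ k ∈ s, q k ≤ ∏ k ∈ s, (1 - q k) := by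
  classical
  induction s using Finset.induction_on with
  | empty => simp
  | insert k s hk ih =>
    rw [Finset.prod_insert hk, Finset.sum_insert hk]
    have h := ih (fun k hk => h0 k (by simp [hk])) (fun k hk => h1 k (by simp [hk]))
    have hle : ∏ k ∈ s, (1 - q k) ≤ 1 :=
      Finset.prod_le_one (fun k hk => by linarith [h1 k (by simp [hk])])
        fun k hk => by linarith [h0 k (by simp [hk])]
    have := h0 k (by simp)
    nlinarith


/-! ### Large deviations for the number of present edges -/

section ProductMeasure

variable {E : Type*} [Fintype E] {ν : E → Measure Bool} [∀ e, IsProbabilityMeasure (ν e)]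

theorem measureReal_forall_eq (F : Finset E) (x : Bool) :
    (Measure.pi ν).real {ω | ∀ e ∈ F, ω e = x} = ∏ e ∈ F, (ν e).real {x} := by
  have h := Measure.pi_pi_finset ν (fun _ => {x}) F
  have hs : {ω : E → Bool | ∀ e ∈ F, ω e = x} = (F : Set E).pi fun _ => {x} := by
    ext ω; simp [Set.mem_pi]
  rw [hs, measureReal_def, h, ENNReal.toReal_prod]
  rfl

/-- First-moment bound on the probability that at least `T` of the edges in `P` are present: one of
the at most `2 ^ |P|` sets of at least `T` edges is present entirely. -/
theorem measureReal_le_card_filter {P : Finset E} {q : ℝ} (hq0 : 0 < q) (hq1 : q ≤ 1)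
    (hP : ∀ e ∈ P, (ν e).real {true} ≤ q) (T : ℝ) :
    (Measure.pi ν).real {ω | T ≤ ((P.filter fun e => ω e = true).card : ℝ)} ≤
      2 ^ P.card * q ^ T := by
  classical
  have hsub : {ω : E → Bool | T ≤ ((P.filter fun e => ω e = true).card : ℝ)} ⊆
      ⋃ F ∈ P.powerset.filter fun F => T ≤ (F.card : ℝ), {ω | ∀ e ∈ F, ω e = true} := by
    intro ω hω
    simp only [Set.mem_iUnion, Finset.mem_filter, Finset.mem_powerset]
    exact ⟨P.filter fun e => ω e = true, ⟨Finset.filter_subset _ _, hω⟩, fun e he => by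
      simpa using (Finset.mem_filter.1 he).2⟩
  refine (measureReal_mono hsub (measure_ne_top _ _)).trans ((measureReal_biUnion_finset_le _ _).trans ?_)
  calc ∑ F ∈ P.powerset.filter (fun F => T ≤ (F.card : ℝ)),
        (Measure.pi ν).real {ω | ∀ e ∈ F, ω e = true}
      ≤ ∑ F ∈ P.powerset.filter (fun F => T ≤ (F.card : ℝ)), q ^ T := by
        refine Finset.sum_le_sum fun F hF => ?_
        obtain ⟨hF, hT⟩ := Finset.mem_filter.1 hF
        rw [measureReal_forall_eq]
        calc ∏ e ∈ F, (ν e).real {true} ≤ ∏ _e ∈ F, q :=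
              Finset.prod_le_prod (fun _ _ => measureReal_nonneg)
                fun e he => hP e (Finset.mem_powerset.1 hF he)
          _ = q ^ (F.card : ℝ) := by simp
          _ ≤ q ^ T := Real.rpow_le_rpow_of_exponent_ge hq0 hq1 hT
    _ ≤ ∑ F ∈ P.powerset, q ^ T :=
        Finset.sum_le_sum_of_subset_of_nonneg (Finset.filter_subset _ _) fun _ _ _ => by positivity
    _ = 2 ^ P.card * q ^ T := by simp

end ProductMeasure

/-! ### Heights, ancestors and complete sets -/

section Tree

variable {b H : ℕ}

/-- The nodes of height `h` of the tree, given by the branches on the way from the root down to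
them. For `h ≥ H` there is one such node. -/
abbrev Node (b H h : ℕ) : Type := {i : Fin H // h ≤ (i : ℕ)} → Fin b

/-- The ancestor of the leaf `u` at height `h`. -/
def ancestor (h : ℕ) (u : Leaf b H) : Node b H h := fun i => u i

/-- The leaves of the subtree rooted at the node `τ`. These are the complete sets of height `h`. -/
def below {h : ℕ} (τ : Node b H h) : Finset (Leaf b H) :=
  Finset.univ.filter fun u => ancestor h u = τ

@[simp]
theorem mem_below {h : ℕ} {τ : Node b H h} {u : Leaf b H} : u ∈ below τ ↔ ancestor h u = τ := by
  simp [below]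

theorem ancestor_eq_iff {h : ℕ} {u v : Leaf b H} :
    ancestor h u = ancestor h v ↔ ∀ i : Fin H, h ≤ (i : ℕ) → u i = v i := by
  simp [ancestor, funext_iff]

theorem mem_subtree_iff {a u : Leaf b H} {k : ℕ} :
    u ∈ subtree a k ↔ ancestor k u = ancestor k a := by
  rw [ancestor_eq_iff]; rfl

theorem ancestor_eq_mono {h k : ℕ} (hk : h ≤ k) {u v : Leaf b H}
    (huv : ancestor h u = ancestor h v) : ancestor k u = ancestor k v := by
  rw [ancestor_eq_iff] at *
  exact fun i hi => huv i (hk.trans hi)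

theorem leafHeight_le_iff {u v : Leaf b H} {k : ℕ} :
    leafHeight u v ≤ k ↔ ancestor k u = ancestor k v := by
  constructor
  · intro h
    have hne : {k : ℕ | ∃ a : Leaf b H, u ∈ subtree a k ∧ v ∈ subtree a k}.Nonempty :=
      ⟨H, u, fun i hi => absurd i.2 (by omega), fun i hi => absurd i.2 (by omega)⟩
    obtain ⟨a, hu, hv⟩ := Nat.sInf_mem hne
    rw [mem_subtree_iff] at hu hv
    exact ancestor_eq_mono h (hu.trans hv.symm)
  · intro h
    exact Nat.sInf_le ⟨v, mem_subtree_iff.2 h, mem_subtree_iff.2 rfl⟩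

theorem leafHeight_le (u v : Leaf b H) : leafHeight u v ≤ H :=
  leafHeight_le_iff.2 (ancestor_eq_iff.2 fun i hi => absurd i.2 (by omega))

theorem card_node (b H h : ℕ) : Fintype.card (Node b H h) = b ^ (H - h) := by
  have : Fintype.card {i : Fin H // h ≤ (i : ℕ)} = H - h := by
    rw [Fintype.card_subtype]
    have e := Finset.card_filter_add_card_filter_not (s := (Finset.univ : Finset (Fin H)))
      (fun i => h ≤ (i : ℕ))
    have e' : (Finset.univ.filter fun i : Fin H => ¬ h ≤ (i : ℕ)).card = min H h := by
      simp only [not_le]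
      exact Fin.card_filter_val_lt
    simp only [Finset.card_univ, Fintype.card_fin] at e
    omega
  simp [this]

theorem card_below {h : ℕ} (τ : Node b H h) : (below τ).card = b ^ min H h := by
  let e := Equiv.piEquivPiSubtypeProd (fun i : Fin H => h ≤ (i : ℕ)) fun _ => Fin b
  have h1 : (below τ).card = Fintype.card ({i : Fin H // ¬ h ≤ (i : ℕ)} → Fin b) := by
    rw [← Finset.card_univ]
    refine Finset.card_bij (fun u _ => (e u).2) (by simp) ?_ ?_
    · intro u hu v hv huv
      rw [mem_below] at hu hv
      exact e.injective (Prod.ext (hu.trans hv.symm) huv)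
    · intro σ _
      refine ⟨e.symm (τ, σ), ?_, by simp⟩
      rw [mem_below]
      exact congrArg Prod.fst (e.apply_symm_apply (τ, σ))
  have h2 : Fintype.card {i : Fin H // ¬ h ≤ (i : ℕ)} = min H h := by
    rw [Fintype.card_subtype]
    simp only [not_le]
    exact Fin.card_filter_val_lt
  rw [h1]
  simp only [Fintype.card_fun, Fintype.card_fin, h2]

theorem card_below_le (hb : 0 < b) {h : ℕ} (τ : Node b H h) : (below τ).card ≤ b ^ h := by
  rw [card_below]
  exact Nat.pow_le_pow_right hb (min_le_right _ _)

theorem ancestor_surjective (hb : 0 < b) (h : ℕ) :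
    Function.Surjective (ancestor h : Leaf b H → Node b H h) := by
  intro τ
  have : 0 < (below τ).card := by rw [card_below]; positivity
  obtain ⟨u, hu⟩ := Finset.card_pos.1 this
  exact ⟨u, mem_below.1 hu⟩

theorem below_injective (hb : 0 < b) (h : ℕ) :
    Function.Injective (below : Node b H h → Finset (Leaf b H)) := by
  intro τ σ hτσ
  obtain ⟨u, rfl⟩ := ancestor_surjective hb h τ
  exact mem_below.1 (hτσ ▸ mem_below.2 rfl)

theorem isComplete_below (hb : 2 ≤ b) {h : ℕ} (hH : h ≤ H) (τ : Node b H h) :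
    IsComplete (below τ) := by
  obtain ⟨a, rfl⟩ := ancestor_surjective (by omega) h τ
  have hmem : h ∈ {k : ℕ | ∃ a' : Leaf b H, ∀ u ∈ below (ancestor h a), u ∈ subtree a' k} :=
    ⟨a, fun u hu => mem_subtree_iff.2 (mem_below.1 hu)⟩
  have hle : setHeight (below (ancestor h a)) ≤ h := Nat.sInf_le hmem
  obtain ⟨a', ha'⟩ := Nat.sInf_mem ⟨h, hmem⟩
  have hcard : (below (ancestor h a)).card ≤ b ^ setHeight (below (ancestor h a)) :=
    (Finset.card_le_card fun u hu => mem_below.2 (mem_subtree_iff.1 (ha' u hu))).trans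
      (card_below_le (by omega) (ancestor (setHeight (below (ancestor h a))) a'))
  refine hcard.antisymm ?_
  rw [card_below, min_eq_right hH]
  exact Nat.pow_le_pow_right (by omega) hle

end Tree

/-! ### The edge law -/

section EdgeLaw

variable {b H : ℕ} {c : ℝ} {hc : 1 < c}

instance : IsProbabilityMeasure (edgeLaw b c hc H) := by
  unfold edgeLaw; infer_instance

theorem edge_true (k : ℕ) :
    (bernoulliMeasure true false (edgeProb c hc k)).real {true} = (c ^ k)⁻¹ := by
  rw [bernoulliMeasure_real_apply_of_mem_of_notMem _ (by trivial) (by simp) (by simp)]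
  rfl

theorem edge_false (k : ℕ) :
    (bernoulliMeasure true false (edgeProb c hc k)).real {false} = 1 - (c ^ k)⁻¹ := by
  rw [bernoulliMeasure_real_apply_of_notMem_of_mem _ (by trivial) (by simp) (by simp)]
  rfl

/-- At least `T` of the edges in `P`, all of them between leaves whose height is at least `k`, are
present with probability at most `2 ^ |P| * c ^ (-k T)`. -/
theorem edgeLaw_le_card_filter {P : Finset (Leaf b H × Leaf b H)} {k : ℕ}
    (hP : ∀ e ∈ P, k ≤ leafHeight e.1 e.2) (T : ℝ) :
    (edgeLaw b c hc H).real {ω | T ≤ ((P.filter fun e => ω e = true).card : ℝ)} ≤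
      2 ^ P.card * Real.exp (-(k * T * Real.log c)) := by
  have hc0 : 0 < c := by linarith
  refine (measureReal_le_card_filter (q := (c ^ k)⁻¹) (by positivity)
    (inv_le_one_of_one_le₀ (one_le_pow₀ hc.le)) (fun e he => ?_) T).trans_eq ?_
  · rw [edge_true]
    exact inv_anti₀ (by positivity) (pow_le_pow_right₀ hc.le (hP e he))
  · rw [Real.rpow_def_of_pos (by positivity), Real.log_inv, Real.log_pow]
    ring_nf

end EdgeLaw


/-! ### The probability that a complete set is a cluster -/

theorem outDegreeInto_toDigraph {V : Type*} (ω : V × V → Bool) (u : V) (M : Finset V) :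
    outDegreeInto (toDigraph ω) u M = (M.filter fun v => ω (u, v) = true).card := by
  unfold outDegreeInto toDigraph
  congr

/-- The out-degree of `u` into `M` as the number of present edges in the set `{u} × M`. -/
theorem outDegreeInto_toDigraph_eq_map {V : Type*} (ω : V × V → Bool) (u : V) (M : Finset V) :
    outDegreeInto (toDigraph ω) u M =
      ((M.map ⟨Prod.mk u, Prod.mk_right_injective u⟩).filter fun e => ω e = true).card := by
  rw [outDegreeInto_toDigraph, Finset.filter_map, Finset.card_map]
  rfl

theorem leafHeight_ancestor_le {b H h : ℕ} {u v a : Leaf b H} (hva : ancestor h v = ancestor h a)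
    (hua : ancestor h u ≠ ancestor h a) : leafHeight u a ≤ leafHeight u v := by
  have huv : ancestor (leafHeight u v) u = ancestor (leafHeight u v) v := leafHeight_le_iff.1 le_rfl
  have hh : h ≤ leafHeight u v := by
    by_contra! hlt
    exact hua ((leafHeight_le_iff.1 hlt.le).trans hva)
  exact leafHeight_le_iff.2 (huv.trans (ancestor_eq_mono hh hva))

/-- Summing a function of the height over the leaves: there are at most `b ^ k` leaves `u` such that
`u` and `a` have height `k`. -/
theorem sum_leafHeight_le {b H d : ℕ} (hb : 0 < b) (a : Leaf b H) {f : ℕ → ℝ} (hf : ∀ k, 0 ≤ f k) :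
    ∑ u ∈ Finset.univ.filter (fun u => d ≤ leafHeight u a), f (leafHeight u a) ≤
      ∑ k ∈ Finset.Ico d (H + 1), (b : ℝ) ^ k * f k := by
  rw [← Finset.sum_fiberwise_of_maps_to (t := Finset.Ico d (H + 1))
    (g := fun u => leafHeight u a)]
  · refine Finset.sum_le_sum fun k _ => ?_
    rw [Finset.sum_congr rfl (g := fun _ => f k) fun u hu => by rw [(Finset.mem_filter.1 hu).2],
      Finset.sum_const, nsmul_eq_mul]
    refine mul_le_mul_of_nonneg_right ?_ (hf k)
    refine le_trans (Nat.cast_le.2 (Finset.card_le_card (t := below (ancestor k a)) fun u hu =>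
      mem_below.2 (leafHeight_le_iff.1 (le_of_eq (Finset.mem_filter.1 hu).2)))) ?_
    exact_mod_cast card_below_le hb (ancestor k a)
  · intro u hu
    have := leafHeight_le u a
    simp only [Finset.mem_filter, Finset.mem_univ, true_and, Finset.mem_Ico] at hu ⊢
    omega

/-- The sum bounds the expected number of vertices at height at least `d` over a complete set of size
`B = b ^ h` that have more than `α B` edges to it. A constant `d` makes it small for all powers
`B > log b / (α log c)` of `b` at once since there is a smallest one among them. -/
theorem exists_height_sum_le {b : ℕ} (hb : 2 ≤ b) {c : ℝ} (hc : 1 < c) {α : ℝ} (hα : 0 < α) :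
    ∃ d : ℕ, ∀ h : ℕ, Real.log b / (α * Real.log c) < (b : ℝ) ^ h → ∀ N : ℕ,
      ∑ k ∈ Finset.Ico d N,
        (b : ℝ) ^ k * (2 ^ (b ^ h) * Real.exp (-(k * (α * (b : ℝ) ^ h) * Real.log c))) ≤ 1 / 2 := by
  have hlc : 0 < Real.log c := Real.log_pos hc
  have hb1 : (1 : ℝ) < b := by exact_mod_cast hb
  have hb0 : (0 : ℝ) < b := by positivity
  have hex : ∃ h : ℕ, Real.log b / (α * Real.log c) < (b : ℝ) ^ h := pow_unbounded_of_one_lt _ hb1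
  classical
  set B₀ : ℝ := (b : ℝ) ^ Nat.find hex
  have hB₀ : 0 < B₀ := by positivity
  -- The ratio `b * c ^ (-α B)` of the series is at most `exp (-θ B)` for `B ≥ B₀`.
  set θ : ℝ := α * Real.log c - Real.log b / B₀ with hθ
  have hθ0 : 0 < θ := by
    have := Nat.find_spec hex
    rw [div_lt_iff₀ (by positivity)] at this
    rw [hθ, sub_pos, div_lt_iff₀ hB₀]
    linarith
  have hρ : Real.exp (-θ) < 1 := by simpa using hθ0
  obtain ⟨d, hd⟩ := exists_pow_lt_of_lt_one (show (0 : ℝ) < (1 - Real.exp (-θ)) / 4 by linarith) hρ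
  refine ⟨d, fun h hh N => ?_⟩
  set B : ℝ := (b : ℝ) ^ h with hB
  have hBB : B₀ ≤ B := pow_le_pow_right₀ hb1.le (Nat.find_min' hex hh)
  have hB1 : 1 ≤ B := one_le_pow₀ hb1.le
  set r : ℝ := b * Real.exp (-(α * B * Real.log c)) with hr
  have hr0 : 0 < r := by positivity
  have hrθ : r ≤ Real.exp (-θ) ^ (b ^ h) := by
    rw [hr, ← Real.exp_nat_mul]
    nth_rw 1 [← Real.exp_log hb0]
    rw [← Real.exp_add, Real.exp_le_exp]
    push_cast
    have h1 : Real.log b ≤ Real.log b / B₀ * B := by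
      rw [div_mul_eq_mul_div, le_div_iff₀ hB₀]
      exact mul_le_mul_of_nonneg_left hBB (Real.log_nonneg hb1.le)
    rw [hθ, ← hB]
    linarith
  have hbh : b ^ h ≠ 0 := by positivity
  have hr1 : r ≤ Real.exp (-θ) :=
    hrθ.trans (pow_le_of_le_one (Real.exp_pos _).le hρ.le hbh)
  calc ∑ k ∈ Finset.Ico d N,
        (b : ℝ) ^ k * (2 ^ (b ^ h) * Real.exp (-(k * (α * B) * Real.log c)))
      = 2 ^ (b ^ h) * ∑ k ∈ Finset.Ico d N, r ^ k := by
        rw [Finset.mul_sum]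
        refine Finset.sum_congr rfl fun k _ => ?_
        rw [hr, mul_pow, ← Real.exp_nat_mul]
        ring_nf
    _ ≤ 2 ^ (b ^ h) * (r ^ d / (1 - r)) := by
        gcongr
        exact geom_sum_Ico_le_of_lt_one hr0.le (hr1.trans_lt hρ)
    _ ≤ 2 ^ (b ^ h) * ((Real.exp (-θ) ^ (b ^ h)) ^ d / (1 - Real.exp (-θ))) := by
        gcongr
    _ = (2 * Real.exp (-θ) ^ d) ^ (b ^ h) / (1 - Real.exp (-θ)) := by
        rw [mul_pow, ← pow_mul, ← pow_mul, mul_comm d]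
        ring
    _ ≤ (2 * Real.exp (-θ) ^ d) / (1 - Real.exp (-θ)) := by
        have : 0 ≤ 1 - Real.exp (-θ) := by linarith
        gcongr
        refine pow_le_of_le_one (by positivity) ?_ hbh
        linarith [Real.exp_pos (-θ)]
    _ ≤ 1 / 2 := by
        rw [div_le_iff₀ (by linarith)]
        linarith

section Cluster

variable {b H : ℕ} {c : ℝ} {hc : 1 < c}

/-- Whether `M` is a cluster depends on the edges into `M` only. -/
theorem dependsOn_isCluster_below (α β : ℝ) {h : ℕ} (τ : Node b H h) :
    DependsOn (· ∈ {ω | IsCluster (toDigraph ω) α β (below τ)}) {e | ancestor h e.2 = τ} := by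
  intro x y hxy
  have hdeg (u) : outDegreeInto (toDigraph x) u (below τ) =
      outDegreeInto (toDigraph y) u (below τ) := by
    rw [outDegreeInto_toDigraph, outDegreeInto_toDigraph]
    congr 1
    refine Finset.filter_congr fun v hv => ?_
    rw [hxy (u, v) (mem_below.1 hv)]
  simp only [Set.mem_ofPred_eq, IsCluster, IsInternallyDense, IsExternallySparse, hdeg]

/-- The edges from `u` are as a directed `(α, β)`-cluster `M` demands it. -/
def goodSource (α β : ℝ) (M : Finset (Leaf b H)) (u : Leaf b H) : Set (Leaf b H × Leaf b H → Bool) :=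
  {ω | (u ∈ M → β * M.card ≤ outDegreeInto (toDigraph ω) u M) ∧
    (u ∉ M → (outDegreeInto (toDigraph ω) u M : ℝ) ≤ α * M.card)}

theorem dependsOn_goodSource (α β : ℝ) (M : Finset (Leaf b H)) (u : Leaf b H) :
    DependsOn (· ∈ goodSource α β M u) {e | e.1 = u} := by
  intro x y hxy
  have hdeg : outDegreeInto (toDigraph x) u M = outDegreeInto (toDigraph y) u M := by
    rw [outDegreeInto_toDigraph, outDegreeInto_toDigraph]
    congr 1
    refine Finset.filter_congr fun v _ => ?_
    rw [hxy (u, v) rfl]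
  simp only [goodSource, Set.mem_ofPred_eq, hdeg]

theorem setOf_isCluster_eq (α β : ℝ) (M : Finset (Leaf b H)) :
    {ω | IsCluster (toDigraph ω) α β M} = ⋂ u ∈ Finset.univ, goodSource α β M u := by
  ext ω
  simp only [Set.mem_ofPred_eq, IsCluster, IsInternallyDense, IsExternallySparse, goodSource,
    Finset.mem_univ, Set.iInter_true, Set.mem_iInter, forall_and]

theorem le_measureReal_goodSource_of_mem {α β : ℝ} (hβ : β ≤ 1) {h : ℕ} {τ : Node b H h}
    {u : Leaf b H} (hu : u ∈ below τ) :
    (c ^ h)⁻¹ ^ (below τ).card ≤ (edgeLaw b c hc H).real (goodSource α β (below τ) u) := by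
  have hc0 : 0 < c := by linarith
  set P := (below τ).map ⟨Prod.mk u, Prod.mk_right_injective u⟩ with hP
  calc (c ^ h)⁻¹ ^ (below τ).card = ∏ _v ∈ below τ, (c ^ h)⁻¹ := by simp
    _ ≤ ∏ v ∈ below τ, (c ^ leafHeight u v)⁻¹ := by
        refine Finset.prod_le_prod (fun _ _ => by positivity) fun v hv => ?_
        refine inv_anti₀ (by positivity) (pow_le_pow_right₀ hc.le (leafHeight_le_iff.2 ?_))
        exact (mem_below.1 hu).trans (mem_below.1 hv).symm
    _ = (edgeLaw b c hc H).real {ω | ∀ e ∈ P, ω e = true} := by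
        rw [edgeLaw, measureReal_forall_eq, hP, Finset.prod_map]
        simp only [edge_true, Function.Embedding.coeFn_mk]
    _ ≤ _ := by
        refine measureReal_mono fun ω hω => ⟨fun _ => ?_, fun h => absurd hu h⟩
        rw [outDegreeInto_toDigraph_eq_map, ← hP, Finset.filter_true_of_mem hω, hP, Finset.card_map]
        exact mul_le_of_le_one_left (Nat.cast_nonneg _) hβ

theorem le_measureReal_goodSource_of_notMem {α β : ℝ} (hα : 0 ≤ α) {h : ℕ} {τ : Node b H h}
    {u : Leaf b H} (hu : u ∉ below τ) :
    (1 - c⁻¹) ^ (below τ).card ≤ (edgeLaw b c hc H).real (goodSource α β (below τ) u) := by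
  have hc0 : 0 < c := by linarith
  have hc1 : c⁻¹ ≤ 1 := inv_le_one_of_one_le₀ hc.le
  set P := (below τ).map ⟨Prod.mk u, Prod.mk_right_injective u⟩ with hP
  calc (1 - c⁻¹) ^ (below τ).card = ∏ _v ∈ below τ, (1 - c⁻¹) := by simp
    _ ≤ ∏ v ∈ below τ, (1 - (c ^ leafHeight u v)⁻¹) := by
        refine Finset.prod_le_prod (fun _ _ => by linarith) fun v hv => ?_
        have hne : leafHeight u v ≠ 0 := fun h0 => hu <| mem_below.2 <|
          (ancestor_eq_mono (Nat.zero_le h) (leafHeight_le_iff.1 h0.le)).trans (mem_below.1 hv)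
        gcongr
        exact le_self_pow₀ hc.le hne
    _ = (edgeLaw b c hc H).real {ω | ∀ e ∈ P, ω e = false} := by
        rw [edgeLaw, measureReal_forall_eq, hP, Finset.prod_map]
        simp only [edge_false, Function.Embedding.coeFn_mk]
    _ ≤ _ := by
        refine measureReal_mono fun ω hω => ⟨fun h => absurd h hu, fun _ => ?_⟩
        rw [outDegreeInto_toDigraph_eq_map, ← hP, Finset.filter_false_of_mem]
        · simp only [Finset.card_empty, Nat.cast_zero]; positivity
        · intro e he
          simp [hω e he]

theorem measureReal_compl_goodSource_le {α β : ℝ} {h : ℕ} {a u : Leaf b H}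
    (hu : u ∉ below (ancestor h a)) :
    (edgeLaw b c hc H).real (goodSource α β (below (ancestor h a)) u)ᶜ ≤
      2 ^ (below (ancestor h a)).card *
        Real.exp (-(leafHeight u a * (α * (below (ancestor h a)).card) * Real.log c)) := by
  set P := (below (ancestor h a)).map ⟨Prod.mk u, Prod.mk_right_injective u⟩ with hP
  have hPk : ∀ e ∈ P, leafHeight u a ≤ leafHeight e.1 e.2 := by
    intro e he
    obtain ⟨v, hv, rfl⟩ := Finset.mem_map.1 he
    exact leafHeight_ancestor_le (mem_below.1 hv) fun h => hu (mem_below.2 h)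
  have hcard : P.card = (below (ancestor h a)).card := Finset.card_map _
  refine le_trans (measureReal_mono ?_) ((edgeLaw_le_card_filter hPk
    (α * (below (ancestor h a)).card)).trans_eq (by rw [hcard]))
  intro ω hω
  simp only [goodSource, hu, Set.mem_compl_iff, Set.mem_ofPred_eq, false_implies, true_and,
    not_false_eq_true, true_implies, not_le] at hω
  rw [outDegreeInto_toDigraph_eq_map] at hω
  exact hω.le

/-- A lower bound for the probability that the complete set below `τ` is a cluster. The first factor
is the price for all edges inside the set, the second one for having no edge from a vertex
outside the set whose height over the set is less than `d`, and the third one is for the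
out-degrees of all the vertices at height at least `d`. -/
theorem le_measureReal_isCluster (hb : 2 ≤ b) {α β : ℝ} (hα : 0 ≤ α) (hβ : β ≤ 1) {h d : ℕ}
    (hH : h ≤ H)
    (hd : ∑ k ∈ Finset.Ico d (H + 1),
        (b : ℝ) ^ k * (2 ^ (b ^ h) * Real.exp (-(k * (α * (b : ℝ) ^ h) * Real.log c))) ≤ 1 / 2)
    (τ : Node b H h) :
    ((c ^ h)⁻¹ ^ (b ^ h)) ^ (b ^ h) * ((1 - c⁻¹) ^ (b ^ h)) ^ (b ^ d) * (1 / 2) ≤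
      (edgeLaw b c hc H).real {ω | IsCluster (toDigraph ω) α β (below τ)} := by
  classical
  obtain ⟨a, rfl⟩ := ancestor_surjective (by omega) h τ
  set M := below (ancestor h a) with hM
  have hMcard : M.card = b ^ h := by rw [hM, card_below, min_eq_right hH]
  have hc0 : 0 < c := by linarith
  have hc1 : 0 ≤ 1 - c⁻¹ := by linarith [inv_le_one_of_one_le₀ hc.le]
  set μ := edgeLaw b c hc H with hμ
  -- `N` and `F` are the outside vertices that are near to and far from `M`.
  set N := Mᶜ.filter fun u => ¬ d ≤ leafHeight u a with hN
  set F := Mᶜ.filter fun u => d ≤ leafHeight u a with hF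
  have hsplit : μ.real {ω | IsCluster (toDigraph ω) α β M} =
      (∏ u ∈ M, μ.real (goodSource α β M u)) * (∏ u ∈ N, μ.real (goodSource α β M u)) *
        ∏ u ∈ F, μ.real (goodSource α β M u) := by
    rw [setOf_isCluster_eq, hμ, edgeLaw,
      measureReal_biInter_of_dependsOn Prod.fst (dependsOn_goodSource α β M), mul_assoc,
      mul_comm (∏ u ∈ N, _), hN, hF, Finset.prod_filter_mul_prod_filter_not,
      Finset.prod_mul_prod_compl]
  have hprodM : ((c ^ h)⁻¹ ^ (b ^ h)) ^ (b ^ h) ≤ ∏ u ∈ M, μ.real (goodSource α β M u) := by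
    rw [← hMcard, ← Finset.prod_const]
    exact Finset.prod_le_prod (fun _ _ => by positivity)
      fun u hu => le_measureReal_goodSource_of_mem hβ hu
  have hprodN : ((1 - c⁻¹) ^ (b ^ h)) ^ (b ^ d) ≤ ∏ u ∈ N, μ.real (goodSource α β M u) := by
    have hNcard : N.card ≤ b ^ d := by
      refine (Finset.card_le_card fun u hu => ?_).trans (card_below_le (by omega) (ancestor d a))
      rw [hN, Finset.mem_filter, not_le] at hu
      exact mem_below.2 (leafHeight_le_iff.1 hu.2.le)
    calc ((1 - c⁻¹) ^ (b ^ h)) ^ (b ^ d) ≤ ((1 - c⁻¹) ^ (b ^ h)) ^ N.card :=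
          pow_le_pow_of_le_one (by positivity)
            (pow_le_one₀ hc1 (by linarith [inv_pos.2 hc0])) hNcard
      _ = ∏ _u ∈ N, (1 - c⁻¹) ^ M.card := by rw [Finset.prod_const, hMcard]
      _ ≤ _ := Finset.prod_le_prod (fun _ _ => by positivity) fun u hu =>
          le_measureReal_goodSource_of_notMem hα (Finset.mem_compl.1 (Finset.mem_filter.1 hu).1)
  have hprodF : 1 / 2 ≤ ∏ u ∈ F, μ.real (goodSource α β M u) := by
    have hsum : ∑ u ∈ F, μ.real (goodSource α β M u)ᶜ ≤ 1 / 2 := by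
      refine le_trans ?_ hd
      refine le_trans ?_ (sum_leafHeight_le (by omega) a
        (f := fun k => 2 ^ (b ^ h) * Real.exp (-(k * (α * (b : ℝ) ^ h) * Real.log c)))
        fun _ => by positivity)
      refine le_trans (Finset.sum_le_sum fun u hu => measureReal_compl_goodSource_le
        (Finset.mem_compl.1 (Finset.mem_filter.1 hu).1)) ?_
      rw [← hM, hMcard]
      push_cast
      exact Finset.sum_le_sum_of_subset_of_nonneg
        (Finset.filter_subset_filter _ (Finset.subset_univ _)) fun _ _ _ => by positivity
    calc 1 / 2 ≤ 1 - ∑ u ∈ F, μ.real (goodSource α β M u)ᶜ := by linarith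
      _ ≤ ∏ u ∈ F, (1 - μ.real (goodSource α β M u)ᶜ) :=
          one_sub_sum_le_prod _ _ (fun _ _ => measureReal_nonneg) fun _ _ => measureReal_le_one
      _ = ∏ u ∈ F, μ.real (goodSource α β M u) :=
          Finset.prod_congr rfl fun u _ => by
            rw [probReal_compl_eq_one_sub (.of_discrete), sub_sub_cancel]
  rw [hsplit]
  gcongr

end Cluster


/-! ### Asymptotics -/

theorem lnN_eq (b H : ℕ) : lnN b H = H * Real.log b := by
  simp [lnN]

theorem exp_lnN {b : ℕ} (hb : 2 ≤ b) (H : ℕ) : Real.exp (lnN b H) = (b : ℝ) ^ H := by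
  have : (0 : ℝ) < b := by positivity
  rw [lnN_eq, Real.exp_nat_mul, Real.exp_log this]

theorem tendsto_lnN {b : ℕ} (hb : 2 ≤ b) : Tendsto (lnN b) atTop atTop := by
  have h : 0 < Real.log b := Real.log_pos (by exact_mod_cast hb)
  simp_rw [funext (lnN_eq b)]
  exact tendsto_natCast_atTop_atTop.atTop_mul_const h

theorem aas_of_le {b : ℕ} {c : ℝ} {hc : 1 < c} {P : (H : ℕ) → Digraph (Leaf b H) → Prop}
    {f : ℕ → ℝ} (hf : Tendsto f atTop (nhds 0))
    (hP : ∀ᶠ H in atTop, (edgeLaw b c hc H).real {ω | ¬ P H (toDigraph ω)} ≤ f H) :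
    AAS b c hc P := by
  have hreal : Tendsto (fun H => (edgeLaw b c hc H).real {ω | P H (toDigraph ω)}) atTop
      (nhds 1) := by
    have h1 : Tendsto (fun H => 1 - f H) atTop (nhds 1) := by simpa using hf.const_sub 1
    refine tendsto_of_tendsto_of_tendsto_of_le_of_le' h1 tendsto_const_nhds ?_
      (Eventually.of_forall fun H => measureReal_le_one)
    filter_upwards [hP] with H hH
    have := probReal_compl_eq_one_sub (μ := edgeLaw b c hc H) (s := {ω | P H (toDigraph ω)})
      (.of_discrete)
    rw [Set.compl_ofPred] at this
    linarith
  have := ENNReal.tendsto_ofReal hreal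
  simpa [AAS] using this

theorem AAS.mono {b : ℕ} {c : ℝ} {hc : 1 < c} {P Q : (H : ℕ) → Digraph (Leaf b H) → Prop}
    (hP : AAS b c hc P) (hPQ : ∀ᶠ H in atTop, ∀ G, P H G → Q H G) : AAS b c hc Q := by
  refine tendsto_of_tendsto_of_tendsto_of_le_of_le' hP tendsto_const_nhds ?_
    (Eventually.of_forall fun H => prob_le_one)
  filter_upwards [hPQ] with H hH
  exact measure_mono fun ω hω => hH _ hω

/-- If `B ^ 2 ≤ L ^ (1 - 2ε)`, then `B ^ 2 * log L` is negligible compared to `L`. -/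
theorem eventually_rpow_mul_log_le (C : ℝ) (hC : 0 ≤ C) {ε : ℝ} (hε : 0 < ε) :
    ∀ᶠ L : ℝ in atTop, ∀ B : ℝ, 0 ≤ B → B ≤ L ^ (1 / 2 - ε) → C * (B ^ 2 * Real.log L) ≤ L / 2 := by
  have h := (isLittleO_log_rpow_atTop (show 0 < 2 * ε by positivity)).bound
    (show 0 < 1 / (2 * (C + 1)) by positivity)
  filter_upwards [h, eventually_ge_atTop 1] with L hL hL1 B hB0 hB
  have hL0 : 0 < L := by linarith
  have hlog : 0 ≤ Real.log L := Real.log_nonneg hL1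
  rw [Real.norm_of_nonneg hlog, Real.norm_of_nonneg (by positivity)] at hL
  calc C * (B ^ 2 * Real.log L)
      ≤ (C + 1) * ((L ^ (1 / 2 - ε)) ^ 2 * (1 / (2 * (C + 1)) * L ^ (2 * ε))) := by
        gcongr
        linarith
    _ = (L ^ (1 / 2 - ε)) ^ 2 * L ^ (2 * ε) / 2 := by field_simp
    _ = L / 2 := by
        rw [← Real.rpow_natCast, ← Real.rpow_mul hL0.le, ← Real.rpow_add hL0]
        norm_num
        ring_nf
        simp

/-! ### Many complete clusters -/

section Count

variable {b H : ℕ} {c : ℝ} {hc : 1 < c}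

theorem card_isCluster_below_le (hb : 2 ≤ b) {h : ℕ} (hH : h ≤ H) (G : Digraph (Leaf b H))
    (α β : ℝ) :
    Nat.card {τ : Node b H h // IsCluster G α β (below τ)} ≤ numCompleteClusters G α β h := by
  refine Nat.card_le_card_of_injective (fun τ => ⟨below τ.1, τ.2, isComplete_below hb hH τ.1, by
    rw [card_below, min_eq_right hH]⟩) fun τ σ hτσ => ?_
  exact Subtype.ext (below_injective (by omega) h (congrArg Subtype.val hτσ))

/-- The events that the different complete sets of height `h` are clusters depend on disjoint sets
of edges, so the number of such clusters is concentrated. -/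
theorem measureReal_numCompleteClusters_le (hb : 2 ≤ b) {α β : ℝ} {h : ℕ} (hH : h ≤ H) {p : ℝ}
    (hp : 0 < p)
    (hpτ : ∀ τ : Node b H h,
      p ≤ (edgeLaw b c hc H).real {ω | IsCluster (toDigraph ω) α β (below τ)}) :
    (edgeLaw b c hc H).real
      {ω | 2 * (numCompleteClusters (toDigraph ω) α β h : ℝ) ≤ (b : ℝ) ^ (H - h) * p} ≤
      4 / ((b : ℝ) ^ (H - h) * p) := by
  classical
  have hcard : (Fintype.card (Node b H h) : ℝ) = (b : ℝ) ^ (H - h) := by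
    rw [card_node]; push_cast; rfl
  have hcheb := measureReal_card_le (fun e : Leaf b H × Leaf b H => ancestor h e.2)
    (fun τ => dependsOn_isCluster_below α β τ) hp hpτ (by rw [card_node]; positivity)
  rw [hcard] at hcheb
  refine le_trans (measureReal_mono fun ω hω => ?_) hcheb
  simp only [Set.mem_ofPred_eq] at hω ⊢
  refine le_trans ?_ hω
  have := card_isCluster_below_le hb hH (toDigraph ω) α β
  gcongr

end Count

/-- The expected number of complete clusters of height `h` is at least `n ^ (1 / 2)` by the bound of
`le_measureReal_isCluster`, and `(log n) ^ (b ^ h)` is smaller than half of this. -/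
theorem exp_half_lnN_le {b : ℕ} (hb : 2 ≤ b) {c : ℝ} (hc : 1 < c) {ε : ℝ} (hε : 0 < ε) (d : ℕ) :
    ∀ᶠ H : ℕ in atTop, ∀ h : ℕ, (h : ℝ) ≤ (1 / 2 - ε) * (Real.log (lnN b H) / Real.log b) →
      h ≤ H ∧ 2 * lnN b H ^ ((b : ℝ) ^ h) ≤ Real.exp (lnN b H / 2) ∧
      Real.exp (lnN b H / 2) ≤ (b : ℝ) ^ (H - h) *
        (((c ^ h)⁻¹ ^ (b ^ h)) ^ (b ^ h) * ((1 - c⁻¹) ^ (b ^ h)) ^ (b ^ d) * (1 / 2)) := by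
  have hb1 : (1 : ℝ) < b := by exact_mod_cast hb
  have hb0 : (0 : ℝ) < b := by positivity
  have hc0 : 0 < c := by linarith
  have hlb : 0 < Real.log b := Real.log_pos hb1
  have hlc : 0 < Real.log c := Real.log_pos hc
  have hcinv : 0 < 1 - c⁻¹ := sub_pos.2 (inv_lt_one_of_one_lt₀ hc)
  set κ : ℝ := -Real.log (1 - c⁻¹) with hκ
  have hκ0 : 0 ≤ κ := by
    rw [hκ, neg_nonneg]
    exact Real.log_nonpos hcinv.le (by linarith [inv_pos.2 hc0])
  set C : ℝ := 1 + Real.log c / Real.log b + b ^ d * κ + Real.log 2 with hC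
  have hlog2 : 0 < Real.log 2 := Real.log_pos one_lt_two
  have hC0 : 0 ≤ C := by positivity
  have hL := tendsto_lnN hb
  filter_upwards [hL.eventually (eventually_rpow_mul_log_le C hC0 hε),
    hL.eventually (eventually_ge_atTop (Real.exp 1))] with H hCL hLe h hup
  set L := lnN b H with hLdef
  have hL0 : 0 < L := (Real.exp_pos 1).trans_le hLe
  set Λ := Real.log L with hΛ
  have hΛ1 : 1 ≤ Λ := by rwa [hΛ, Real.le_log_iff_exp_le hL0]
  have hΛ0 : 0 ≤ Λ := by linarith
  set B : ℝ := (b : ℝ) ^ h with hB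
  have hB1 : 1 ≤ B := one_le_pow₀ hb1.le
  have hBB : B ≤ B ^ 2 := le_self_pow₀ hB1 two_ne_zero
  have hhlog : h * Real.log b ≤ (1 / 2 - ε) * Λ := by
    rwa [← mul_div_assoc, le_div_iff₀ hlb] at hup
  have hBL : B ≤ L ^ (1 / 2 - ε) := by
    rw [hB, Real.rpow_def_of_pos hL0, ← Real.rpow_natCast, Real.rpow_def_of_pos hb0]
    exact Real.exp_le_exp.2 (by linarith)
  have hhΛ : h * Real.log b ≤ Λ :=
    hhlog.trans (mul_le_of_le_one_left hΛ0 (by linarith))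
  have hhH : h ≤ H := by
    have h1 : h * Real.log b ≤ H * Real.log b :=
      (hhΛ.trans (Real.log_le_self hL0.le)).trans_eq (lnN_eq b H)
    exact_mod_cast le_of_mul_le_mul_right h1 hlb
  have hCB := hCL B (by linarith) hBL
  have e0 : Λ ≤ B ^ 2 * Λ := le_mul_of_one_le_left hΛ0 (hB1.trans hBB)
  have e1 : h * Real.log b ≤ B ^ 2 * Λ := hhΛ.trans e0
  have e2 : h * B ^ 2 * Real.log c ≤ Real.log c / Real.log b * (B ^ 2 * Λ) := by
    rw [div_mul_eq_mul_div, le_div_iff₀ hlb]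
    calc h * B ^ 2 * Real.log c * Real.log b = B ^ 2 * Real.log c * (h * Real.log b) := by ring
      _ ≤ B ^ 2 * Real.log c * Λ := by gcongr
      _ = _ := by ring
  have e3 : B * b ^ d * κ ≤ b ^ d * κ * (B ^ 2 * Λ) := by
    calc B * b ^ d * κ = b ^ d * κ * B := by ring
      _ ≤ b ^ d * κ * (B ^ 2 * Λ) := by
        gcongr
        exact hBB.trans (le_mul_of_one_le_right (by positivity) hΛ1)
  have e4 : Real.log 2 ≤ Real.log 2 * (B ^ 2 * Λ) :=
    le_mul_of_one_le_right hlog2.le (hΛ1.trans e0)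
  have e5 : B * Λ ≤ B ^ 2 * Λ := by gcongr
  have e6 : 0 ≤ Real.log c / Real.log b * (B ^ 2 * Λ) := by positivity
  have e7 : 0 ≤ b ^ d * κ * (B ^ 2 * Λ) := by positivity
  have hexpand : C * (B ^ 2 * Λ) = B ^ 2 * Λ + Real.log c / Real.log b * (B ^ 2 * Λ) +
      b ^ d * κ * (B ^ 2 * Λ) + Real.log 2 * (B ^ 2 * Λ) := by rw [hC]; ring
  rw [hexpand] at hCB
  refine ⟨hhH, ?_, ?_⟩
  · rw [Real.rpow_def_of_pos hL0]
    nth_rw 1 [← Real.exp_log two_pos]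
    rw [← Real.exp_add, Real.exp_le_exp, mul_comm (Real.log L)]
    linarith only [hCB, e4, e5, e6, e7]
  · have hκ' : Real.log (1 - c⁻¹) = -κ := by rw [hκ, neg_neg]
    have hlogp : Real.log ((b : ℝ) ^ (H - h) *
        (((c ^ h)⁻¹ ^ (b ^ h)) ^ (b ^ h) * ((1 - c⁻¹) ^ (b ^ h)) ^ (b ^ d) * (1 / 2))) =
        L - h * Real.log b - h * B ^ 2 * Real.log c - B * b ^ d * κ - Real.log 2 := by
      rw [Real.log_mul (by positivity) (by positivity),
        Real.log_mul (by positivity) (by positivity), Real.log_mul (by positivity) (by positivity)]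
      simp only [Real.log_pow, Real.log_inv, one_div]
      push_cast [Nat.cast_sub hhH]
      rw [← hB, hκ', hLdef, lnN_eq]
      ring
    rw [← Real.le_log_iff_exp_le (by positivity), hlogp]
    linarith only [hCB, e1, e2, e3, e4]

/-- A.a.s. there are at least `(log n) ^ (b ^ h)` complete clusters of an admissible height `h`. In
fact their expected number is `n ^ (1 - o(1))`. -/
theorem aas_numCompleteClusters {b : ℕ} (hb : 2 ≤ b) {c : ℝ} (hc : 1 < c) {α β ε : ℝ} (hα : 0 < α)
    (hβ : β ≤ 1) (hε : 0 < ε) {h : ℕ → ℕ}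
    (hh : ∀ᶠ H : ℕ in atTop,
      Real.logb b (Real.log b / (α * Real.log c)) < (h H : ℝ) ∧
      (h H : ℝ) ≤ (1 / 2 - ε) * (Real.log (lnN b H) / Real.log b)) :
    AAS b c hc fun H G =>
      lnN b H ^ ((b : ℝ) ^ h H) ≤ (numCompleteClusters G α β (h H) : ℝ) := by
  have hb1 : (1 : ℝ) < b := by exact_mod_cast hb
  have hc0 : 0 < c := by linarith
  have hlb : 0 < Real.log b := Real.log_pos hb1
  have hlc : 0 < Real.log c := Real.log_pos hc
  have hcinv : 0 < 1 - c⁻¹ := sub_pos.2 (inv_lt_one_of_one_lt₀ hc)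
  obtain ⟨d, hd⟩ := exists_height_sum_le hb hc hα
  refine aas_of_le (f := fun H => 4 / Real.exp (lnN b H / 2)) ?_ ?_
  · exact tendsto_const_nhds.div_atTop
      (Real.tendsto_exp_atTop.comp ((tendsto_lnN hb).atTop_div_const two_pos))
  filter_upwards [hh, exp_half_lnN_le hb hc hε d] with H ⟨hlow, hup⟩ hH
  obtain ⟨hhH, hLB, hpexp⟩ := hH (h H) hup
  have hmstar : Real.log b / (α * Real.log c) < (b : ℝ) ^ h H := by
    rw [← Real.rpow_natCast]
    exact (Real.logb_lt_iff_lt_rpow hb1 (by positivity)).1 hlow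
  set p : ℝ := ((c ^ h H)⁻¹ ^ (b ^ h H)) ^ (b ^ h H) * ((1 - c⁻¹) ^ (b ^ h H)) ^ (b ^ d) * (1 / 2)
    with hp
  calc (edgeLaw b c hc H).real {ω | ¬ lnN b H ^ ((b : ℝ) ^ h H) ≤
          (numCompleteClusters (toDigraph ω) α β (h H) : ℝ)}
      ≤ (edgeLaw b c hc H).real {ω | 2 * (numCompleteClusters (toDigraph ω) α β (h H) : ℝ) ≤
          (b : ℝ) ^ (H - h H) * p} := by
        refine measureReal_mono fun ω hω => ?_
        simp only [Set.mem_ofPred_eq, not_le] at hω ⊢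
        linarith
    _ ≤ 4 / ((b : ℝ) ^ (H - h H) * p) :=
        measureReal_numCompleteClusters_le hb hhH (by positivity)
          fun τ => le_measureReal_isCluster hb hα.le hβ hhH (hd _ hmstar _) τ
    _ ≤ 4 / Real.exp (lnN b H / 2) := by gcongr

/-- A.a.s. there is a cluster with more than `(log n) ^ (1 / 2 - ε)` vertices: a complete one of the
largest height for which `aas_numCompleteClusters` applies with a smaller `ε`. -/
theorem aas_exists_isCluster {b : ℕ} (hb : 2 ≤ b) {c : ℝ} (hc : 1 < c) {α β ε : ℝ} (hα : 0 < α)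
    (hβ : β ≤ 1) (hε : 0 < ε) :
    AAS b c hc fun H G => ∃ M : Finset (Leaf b H), IsCluster G α β M ∧
      lnN b H ^ (1 / 2 - ε) < (M.card : ℝ) := by
  have hb1 : (1 : ℝ) < b := by exact_mod_cast hb
  have hb0 : (0 : ℝ) < b := by positivity
  have hlb : 0 < Real.log b := Real.log_pos hb1
  have hL := tendsto_lnN hb
  -- A smaller `ε` is a stronger claim; `δ < 1 / 2` makes the height tend to infinity.
  set δ : ℝ := min ε (1 / 4) with hδ
  have hδ0 : 0 < δ := by positivity
  have hδε : δ ≤ ε := min_le_left _ _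
  have hδ4 : δ ≤ 1 / 4 := min_le_right _ _
  have hloglog : Tendsto (fun H => Real.log (lnN b H) / Real.log b) atTop atTop :=
    (Real.tendsto_log_atTop.comp hL).atTop_div_const hlb
  let h : ℕ → ℕ := fun H => ⌊(1 / 2 - δ / 2) * (Real.log (lnN b H) / Real.log b)⌋₊
  have hx : Tendsto (fun H => (1 / 2 - δ / 2) * (Real.log (lnN b H) / Real.log b)) atTop atTop :=
    hloglog.const_mul_atTop (by linarith)
  have hcl := aas_numCompleteClusters hb hc (β := β) (ε := δ / 2) hα hβ (by positivity) (h := h) (by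
    have ht : Tendsto (fun H => (h H : ℝ)) atTop atTop :=
      tendsto_natCast_atTop_atTop.comp (tendsto_nat_floor_atTop.comp hx)
    filter_upwards [ht.eventually (eventually_gt_atTop _), hx.eventually (eventually_ge_atTop 0)]
      with H h1 h2
    exact ⟨h1, Nat.floor_le h2⟩)
  refine hcl.mono ?_
  -- The rounding of the height costs a factor `b`, which the gain `L ^ (δ / 2)` outweighs.
  have hgain := ((tendsto_rpow_atTop (show 0 < δ / 2 by positivity)).comp hL).eventually
    (eventually_ge_atTop (b : ℝ))
  filter_upwards [hgain, hL.eventually (eventually_gt_atTop 1)] with H hgain hL1 G hG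
  have hL0 : 0 < lnN b H := by linarith
  have hpos : (0 : ℝ) < numCompleteClusters G α β (h H) := (Real.rpow_pos_of_pos hL0 _).trans_le hG
  have hne : {M : Finset (Leaf b H) |
      IsCluster G α β M ∧ IsComplete M ∧ M.card = b ^ h H}.Nonempty := by
    refine Set.nonempty_of_ncard_ne_zero ?_
    rw [numCompleteClusters, Nat.cast_pos] at hpos
    exact hpos.ne'
  obtain ⟨M, hM, -, hcard⟩ := hne
  refine ⟨M, hM, ?_⟩
  rw [hcard]
  push_cast
  have hfloor : (1 / 2 - δ / 2) * (Real.log (lnN b H) / Real.log b) < h H + 1 :=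
    Nat.lt_floor_add_one _
  have hlt : lnN b H ^ (1 / 2 - δ / 2) < (b : ℝ) ^ h H * b := by
    rw [← pow_succ, ← Real.rpow_natCast, Real.rpow_def_of_pos hL0, Real.rpow_def_of_pos hb0,
      Real.exp_lt_exp]
    rw [← mul_div_assoc, div_lt_iff₀ hlb] at hfloor
    push_cast
    linarith
  have hsplit : lnN b H ^ (1 / 2 - δ / 2) = lnN b H ^ (1 / 2 - δ) * lnN b H ^ (δ / 2) := by
    rw [← Real.rpow_add hL0]
    ring_nf
  rw [hsplit] at hlt
  have h3 : lnN b H ^ (1 / 2 - δ) * b < (b : ℝ) ^ h H * b :=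
    (mul_le_mul_of_nonneg_left hgain (by positivity)).trans_lt hlt
  exact (Real.rpow_le_rpow_of_exponent_le hL1.le (by linarith)).trans_lt
    (lt_of_mul_lt_mul_right h3 hb0.le)


/-! ### No large clusters -/

section Dense

variable {b H : ℕ} {c : ℝ} {hc : 1 < c}

theorem IsInternallyDense.le_card_edges {V : Type*} {ω : V × V → Bool} {β : ℝ} {M : Finset V}
    (hM : IsInternallyDense (toDigraph ω) β M) :
    β * (M.card : ℝ) ^ 2 ≤ ((M ×ˢ M).filter fun e => ω e = true).card := by
  have h : ((M ×ˢ M).filter fun e => ω e = true).card =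
      ∑ u ∈ M, outDegreeInto (toDigraph ω) u M := by
    simp only [outDegreeInto_toDigraph, Finset.card_filter, Finset.sum_product]
  rw [h]
  push_cast
  calc β * (M.card : ℝ) ^ 2 = ∑ _u ∈ M, β * (M.card : ℝ) := by
        rw [Finset.sum_const, nsmul_eq_mul]; ring
    _ ≤ _ := Finset.sum_le_sum hM

/-- `ω` has a vertex set of size `m` with at least `(β / 2) m ^ 2` edges between leaves whose height is at
least `m`. -/
def manyLongEdges (b H : ℕ) (β : ℝ) (m : ℕ) : Set (Leaf b H × Leaf b H → Bool) :=
  {ω | ∃ M : Finset (Leaf b H), M.card = m ∧ β / 2 * (m : ℝ) ^ 2 ≤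
    (((M ×ˢ M).filter fun e => m ≤ leafHeight e.1 e.2).filter fun e => ω e = true).card}

/-- `ω` has a vertex set of size `s` and height at most `2 s / β` with at least `(β / 2) s ^ 2`
edges. -/
def lowDenseSet (b H : ℕ) (β : ℝ) (s : ℕ) : Set (Leaf b H × Leaf b H → Bool) :=
  {ω | ∃ τ : Node b H ⌊2 * s / β⌋₊, ∃ S ⊆ below τ, S.card = s ∧
    β / 2 * (s : ℝ) ^ 2 ≤ ((S ×ˢ S).filter fun e => ω e = true).card}

/-- An internally dense set of size `m` has many edges between leaves of height at least `m`, or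
its intersection with some subtree of height `m` has many edges. In the second case that
intersection is large itself, so that the height `m` is at most proportional to its size. -/
theorem IsInternallyDense.mem_manyLongEdges_or {ω : Leaf b H × Leaf b H → Bool} {β : ℝ}
    (hβ : 0 < β) {M : Finset (Leaf b H)} (hM : IsInternallyDense (toDigraph ω) β M)
    (hM0 : M.Nonempty) :
    ω ∈ manyLongEdges b H β M.card ∨
      ∃ s : ℕ, s ≤ M.card ∧ β / 2 * M.card ≤ s ∧ ω ∈ lowDenseSet b H β s := by
  classical
  set m := M.card with hm
  have hm0 : 0 < m := Finset.card_pos.2 hM0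
  by_cases hfar : β / 2 * (m : ℝ) ^ 2 ≤
      (((M ×ˢ M).filter fun e => m ≤ leafHeight e.1 e.2).filter fun e => ω e = true).card
  · exact Or.inl ⟨M, rfl, hfar⟩
  right
  set N := ((M ×ˢ M).filter fun e => ω e = true).filter fun e => ¬ m ≤ leafHeight e.1 e.2 with hN
  have hNcard : β / 2 * (m : ℝ) ^ 2 ≤ N.card := by
    have h1 := hM.le_card_edges
    rw [← Finset.card_filter_add_card_filter_not
        (fun e : Leaf b H × Leaf b H => m ≤ leafHeight e.1 e.2), Finset.filter_comm, ← hN] at h1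
    push_cast at h1
    linarith
  let S (τ : Node b H m) : Finset (Leaf b H) := M.filter fun u => ancestor m u = τ
  set I := M.image (ancestor m) with hI
  have hmaps : ∀ u ∈ M, ancestor m u ∈ I := fun u hu => Finset.mem_image_of_mem _ hu
  have hMsum : m = ∑ τ ∈ I, (S τ).card := Finset.card_eq_sum_card_fiberwise hmaps
  have hNsum : N.card = ∑ τ ∈ I, (N.filter fun e => ancestor m e.1 = τ).card :=
    Finset.card_eq_sum_card_fiberwise fun e he => hmaps _
      (Finset.mem_product.1 (Finset.mem_filter.1 (Finset.mem_filter.1 he).1).1).1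
  obtain ⟨τ, hτ, hle⟩ : ∃ τ ∈ I, β / 2 * m * ((S τ).card : ℝ) ≤
      (N.filter fun e => ancestor m e.1 = τ).card := by
    refine Finset.exists_le_of_sum_le (hM0.image _) ?_
    rw [← Finset.mul_sum, ← Nat.cast_sum, ← Nat.cast_sum, ← hNsum, ← hMsum]
    linarith
  obtain ⟨u, hu, rfl⟩ := Finset.mem_image.1 hτ
  set s := (S (ancestor m u)).card with hs
  have hs0 : (0 : ℝ) < s := by
    rw [hs, Nat.cast_pos, Finset.card_pos]
    exact ⟨u, Finset.mem_filter.2 ⟨hu, rfl⟩⟩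
  have hsm : s ≤ m := Finset.card_le_card (Finset.filter_subset _ _)
  have hsub : (N.filter fun e => ancestor m e.1 = ancestor m u) ⊆
      (S (ancestor m u) ×ˢ S (ancestor m u)).filter fun e => ω e = true := by
    intro e he
    simp only [hN, Finset.mem_filter, Finset.mem_product, S] at he ⊢
    obtain ⟨⟨⟨⟨h1, h2⟩, hω⟩, hlow⟩, hanc⟩ := he
    exact ⟨⟨⟨h1, hanc⟩, h2, (leafHeight_le_iff.1 (not_le.1 hlow).le).symm.trans hanc⟩, hω⟩
  have hedges : β / 2 * m * s ≤
      ((S (ancestor m u) ×ˢ S (ancestor m u)).filter fun e => ω e = true).card :=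
    hle.trans (by exact_mod_cast Finset.card_le_card hsub)
  have hupper : (((S (ancestor m u) ×ˢ S (ancestor m u)).filter fun e => ω e = true).card : ℝ) ≤
      s * s := by
    exact_mod_cast (Finset.card_filter_le _ _).trans_eq (Finset.card_product _ _)
  have hms : β / 2 * m ≤ s := le_of_mul_le_mul_right (hedges.trans hupper) hs0
  refine ⟨s, hsm, hms, ancestor _ u, S (ancestor m u), ?_, rfl, ?_⟩
  · -- `S` has height at most `m`, and `m ≤ 2 s / β`.
    intro v hv
    refine mem_below.2 (ancestor_eq_mono (Nat.le_floor ?_) (Finset.mem_filter.1 hv).2)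
    rw [le_div_iff₀ hβ]
    linarith
  · refine le_trans ?_ hedges
    rw [sq, ← mul_assoc]
    gcongr

theorem card_filter_leafHeight_le (hb : 0 < b) (S : Finset (Leaf b H)) (J : ℕ) :
    ((S ×ˢ S).filter fun e => leafHeight e.1 e.2 ≤ J).card ≤ S.card * b ^ J := by
  classical
  simp only [Finset.card_filter, Finset.sum_product]
  rw [← smul_eq_mul]
  refine Finset.sum_le_card_nsmul _ _ _ fun u _ => ?_
  rw [← Finset.card_filter]
  refine (Finset.card_le_card fun v hv => ?_).trans (card_below_le hb (ancestor J u))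
  exact mem_below.2 (leafHeight_le_iff.1 (Finset.mem_filter.1 hv).2).symm

theorem card_leaf (b H : ℕ) : Fintype.card (Leaf b H) = b ^ H := by simp

theorem measureReal_manyLongEdges_le (β : ℝ) (m : ℕ) :
    (edgeLaw b c hc H).real (manyLongEdges b H β m) ≤
      ((b : ℝ) ^ H) ^ m *
        (2 ^ (m ^ 2) * Real.exp (-(m * (β / 2 * (m : ℝ) ^ 2) * Real.log c))) := by
  classical
  have hsub : manyLongEdges b H β m ⊆ ⋃ M ∈ (Finset.univ : Finset (Leaf b H)).powersetCard m,
      {ω | β / 2 * (m : ℝ) ^ 2 ≤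
        (((M ×ˢ M).filter fun e => m ≤ leafHeight e.1 e.2).filter fun e => ω e = true).card} := by
    rintro ω ⟨M, hM, hω⟩
    simp only [Set.mem_iUnion]
    exact ⟨M, Finset.mem_powersetCard.2 ⟨Finset.subset_univ _, hM⟩, hω⟩
  refine (measureReal_mono hsub (measure_ne_top _ _)).trans
    ((measureReal_biUnion_finset_le _ _).trans ?_)
  have hcard : (((Finset.univ : Finset (Leaf b H)).powersetCard m).card : ℝ) ≤ ((b : ℝ) ^ H) ^ m := by
    rw [Finset.card_powersetCard, Finset.card_univ, card_leaf]
    exact_mod_cast Nat.choose_le_pow _ _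
  refine (Finset.sum_le_card_nsmul _ _
    (2 ^ (m ^ 2) * Real.exp (-(m * (β / 2 * (m : ℝ) ^ 2) * Real.log c))) fun M hM => ?_).trans ?_
  · refine (edgeLaw_le_card_filter (k := m) (fun e he => (Finset.mem_filter.1 he).2)
      (β / 2 * (m : ℝ) ^ 2)).trans ?_
    gcongr
    · norm_num
    · refine (Finset.card_filter_le _ _).trans_eq ?_
      rw [Finset.card_product, (Finset.mem_powersetCard.1 hM).2, sq]
  · rw [nsmul_eq_mul]
    gcongr

theorem measureReal_lowDenseSet_le (hb : 2 ≤ b) {β : ℝ} {s J : ℕ}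
    (hJ : (b : ℝ) ^ J ≤ β / 4 * s) :
    (edgeLaw b c hc H).real (lowDenseSet b H β s) ≤
      (b : ℝ) ^ H * ((b : ℝ) ^ ⌊2 * s / β⌋₊) ^ s *
        (2 ^ (s ^ 2) * Real.exp (-(J * (β / 4 * (s : ℝ) ^ 2) * Real.log c))) := by
  classical
  set K := ⌊2 * s / β⌋₊ with hK
  have hsub : lowDenseSet b H β s ⊆
      ⋃ x ∈ (Finset.univ : Finset (Node b H K)).sigma fun τ => (below τ).powersetCard s,
      {ω | β / 4 * (s : ℝ) ^ 2 ≤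
        (((x.2 ×ˢ x.2).filter fun e => J ≤ leafHeight e.1 e.2).filter
          fun e => ω e = true).card} := by
    rintro ω ⟨τ, S, hS, hSs, hω⟩
    simp only [Set.mem_iUnion]
    refine ⟨⟨τ, S⟩, Finset.mem_sigma.2 ⟨Finset.mem_univ _, Finset.mem_powersetCard.2 ⟨hS, hSs⟩⟩, ?_⟩
    have h1 : ((S ×ˢ S).filter fun e => ω e = true).card ≤
        (((S ×ˢ S).filter fun e => J ≤ leafHeight e.1 e.2).filter fun e => ω e = true).card +
          S.card * b ^ J := by
      rw [← Finset.card_filter_add_card_filter_not (fun e => J ≤ leafHeight e.1 e.2),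
        Finset.filter_comm]
      refine Nat.add_le_add_left ((Finset.card_le_card fun e he => ?_).trans
        (card_filter_leafHeight_le (by omega) S J)) _
      simp only [Finset.mem_filter] at he ⊢
      exact ⟨he.1.1, by omega⟩
    have h2 : β / 2 * (s : ℝ) ^ 2 ≤
        (((S ×ˢ S).filter fun e => J ≤ leafHeight e.1 e.2).filter fun e => ω e = true).card +
          s * (b : ℝ) ^ J := by
      refine hω.trans ?_
      rw [← hSs]
      exact_mod_cast h1
    -- At most `s * b ^ J` of the edges are short, which is half of the edges at most.
    have h3 : s * (b : ℝ) ^ J ≤ s * (β / 4 * s) := by gcongr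
    simp only [Set.mem_ofPred_eq]
    linarith
  refine (measureReal_mono hsub (measure_ne_top _ _)).trans
    ((measureReal_biUnion_finset_le _ _).trans ?_)
  have hcard : (((Finset.univ : Finset (Node b H K)).sigma
      fun τ => (below τ).powersetCard s).card : ℝ) ≤ (b : ℝ) ^ H * ((b : ℝ) ^ K) ^ s := by
    have h1 : ((Finset.univ : Finset (Node b H K)).sigma
        fun τ => (below τ).powersetCard s).card ≤ b ^ H * (b ^ K) ^ s := by
      rw [Finset.card_sigma]
      refine (Finset.sum_le_card_nsmul _ _ ((b ^ K) ^ s) fun τ _ => ?_).trans ?_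
      · rw [Finset.card_powersetCard]
        exact (Nat.choose_le_pow _ _).trans
          (Nat.pow_le_pow_left (card_below_le (by omega) τ) s)
      · rw [smul_eq_mul, Finset.card_univ, card_node]
        gcongr
        · omega
        · omega
    exact_mod_cast h1
  refine (Finset.sum_le_card_nsmul _ _
    (2 ^ (s ^ 2) * Real.exp (-(J * (β / 4 * (s : ℝ) ^ 2) * Real.log c))) fun x hx => ?_).trans ?_
  · refine (edgeLaw_le_card_filter (k := J) (fun e he => (Finset.mem_filter.1 he).2)
      (β / 4 * (s : ℝ) ^ 2)).trans ?_
    gcongr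
    · norm_num
    · refine (Finset.card_filter_le _ _).trans_eq ?_
      rw [Finset.card_product, (Finset.mem_powersetCard.1 (Finset.mem_sigma.1 hx).2).2, sq]
  · rw [nsmul_eq_mul]
    gcongr

end Dense

section Asymptotic

variable {b : ℕ} {c : ℝ} {hc : 1 < c}

/-- The cubic exponent of `m` beats the `n ^ m` choices of the set as soon as `m ^ 2` exceeds a
constant multiple of `log n`. -/
theorem measureReal_manyLongEdges_le_exp (hb : 2 ≤ b) {H m : ℕ} {β : ℝ}
    (hm1 : 1 ≤ m) (hm : Real.log 2 ≤ β * Real.log c / 4 * m)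
    (hmL : 3 * lnN b H ≤ β * Real.log c / 4 * (m : ℝ) ^ 2) :
    (edgeLaw b c hc H).real (manyLongEdges b H β m) ≤ Real.exp (-(2 * lnN b H)) := by
  refine (measureReal_manyLongEdges_le β m).trans ?_
  have hL0 : 0 ≤ lnN b H := by rw [lnN_eq]; positivity
  have hm1' : (1 : ℝ) ≤ m := by exact_mod_cast hm1
  have h2 : (2 : ℝ) ^ (m ^ 2) = Real.exp ((m : ℝ) ^ 2 * Real.log 2) := by
    rw [mul_comm, Real.exp_mul, Real.exp_log two_pos]
    exact_mod_cast (Real.rpow_natCast 2 (m ^ 2)).symm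
  rw [← exp_lnN hb, ← Real.exp_nat_mul, h2, ← Real.exp_add, ← Real.exp_add, Real.exp_le_exp]
  set L := lnN b H
  have h3 : m * Real.log 2 ≤ m * (β * Real.log c / 4 * m) := by gcongr
  calc m * L + ((m : ℝ) ^ 2 * Real.log 2 + -(m * (β / 2 * (m : ℝ) ^ 2) * Real.log c))
      = m * (L + m * Real.log 2 - β * Real.log c / 2 * (m : ℝ) ^ 2) := by ring
    _ ≤ m * (-(2 * L)) := by
        gcongr
        linarith
    _ ≤ -(2 * L) := by nlinarith

/-- A given set of size `s` is dense with probability at most `exp (-K s ^ 2)`, with `K` as large as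
one wishes, since only a bounded number of edges from a given vertex have a small height. This beats
the number `n * b ^ (O (s ^ 2))` of sets of height `O (s)` as soon as `s ^ 2` exceeds a multiple of
`log n`. -/
theorem measureReal_lowDenseSet_le_exp (hb : 2 ≤ b) {H s J : ℕ} {β : ℝ} (hβ : 0 < β)
    (hJ : 2 / β * Real.log b + Real.log 2 + 1 ≤ β * Real.log c / 4 * J)
    (hJs : (b : ℝ) ^ J ≤ β / 4 * s) (hsL : 3 * lnN b H ≤ (s : ℝ) ^ 2) :
    (edgeLaw b c hc H).real (lowDenseSet b H β s) ≤ Real.exp (-(2 * lnN b H)) := by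
  refine (measureReal_lowDenseSet_le hb hJs).trans ?_
  have hb1 : (1 : ℝ) < b := by exact_mod_cast hb
  have hlb : 0 < Real.log b := Real.log_pos hb1
  have h2 : (2 : ℝ) ^ (s ^ 2) = Real.exp ((s : ℝ) ^ 2 * Real.log 2) := by
    rw [mul_comm, Real.exp_mul, Real.exp_log two_pos]
    exact_mod_cast (Real.rpow_natCast 2 (s ^ 2)).symm
  have hbK : ((b : ℝ) ^ ⌊2 * s / β⌋₊) ^ s ≤ Real.exp ((s : ℝ) ^ 2 * (2 / β * Real.log b)) := by
    rw [← pow_mul, ← Real.rpow_natCast, Real.rpow_def_of_pos (by linarith), Real.exp_le_exp]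
    push_cast
    calc Real.log b * (⌊2 * s / β⌋₊ * s) ≤ Real.log b * ((2 * s / β) * s) := by
          gcongr
          exact Nat.floor_le (by positivity)
      _ = _ := by ring
  calc (b : ℝ) ^ H * ((b : ℝ) ^ ⌊2 * s / β⌋₊) ^ s *
        (2 ^ (s ^ 2) * Real.exp (-(J * (β / 4 * (s : ℝ) ^ 2) * Real.log c)))
      ≤ Real.exp (lnN b H) * Real.exp ((s : ℝ) ^ 2 * (2 / β * Real.log b)) *
        (2 ^ (s ^ 2) * Real.exp (-(J * (β / 4 * (s : ℝ) ^ 2) * Real.log c))) := by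
        rw [← exp_lnN hb]
        gcongr
    _ ≤ Real.exp (-(2 * lnN b H)) := by
        rw [h2, ← Real.exp_add, ← Real.exp_add, ← Real.exp_add, Real.exp_le_exp]
        nlinarith [mul_le_mul_of_nonneg_left hJ (sq_nonneg (s : ℝ))]

/-- Every size above `(log n) ^ (1 / 2 + ε)` exceeds every constant, and its square every multiple
of `log n`. -/
theorem eventually_forall_rpow_lt (hb : 2 ≤ b) {ε : ℝ} (hε : 0 < ε) (m₀ D : ℝ) :
    ∀ᶠ H : ℕ in atTop, ∀ x : ℝ, lnN b H ^ (1 / 2 + ε) < x → m₀ ≤ x ∧ D * lnN b H ≤ x ^ 2 := by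
  have hL := tendsto_lnN hb
  filter_upwards [hL.eventually (eventually_gt_atTop 0),
    ((tendsto_rpow_atTop (show 0 < 1 / 2 + ε by positivity)).comp hL).eventually
      (eventually_ge_atTop m₀),
    ((tendsto_rpow_atTop (show 0 < 2 * ε by positivity)).comp hL).eventually
      (eventually_ge_atTop D)] with H hL0 h1 h2 x hx
  refine ⟨le_trans h1 hx.le, ?_⟩
  calc D * lnN b H ≤ lnN b H ^ (2 * ε) * lnN b H := by
        gcongr
        exact h2
    _ = (lnN b H ^ (1 / 2 + ε)) ^ 2 := by
        rw [← Real.rpow_natCast, ← Real.rpow_mul hL0.le]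
        nth_rw 2 [← Real.rpow_one (lnN b H)]
        rw [← Real.rpow_add hL0]
        congr 1
        push_cast
        ring
    _ ≤ x ^ 2 := by gcongr

theorem aas_not_exists_isInternallyDense (hb : 2 ≤ b) {β ε : ℝ} (hβ : 0 < β) (hε : 0 < ε) :
    AAS b c hc fun H G => ¬ ∃ M : Finset (Leaf b H), IsInternallyDense G β M ∧
      lnN b H ^ (1 / 2 + ε) < (M.card : ℝ) := by
  classical
  have hlc : 0 < Real.log c := Real.log_pos hc
  set A : ℝ := β * Real.log c / 4 with hA
  have hA0 : 0 < A := by positivity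
  obtain ⟨J, hJ⟩ := exists_nat_ge ((2 / β * Real.log b + Real.log 2 + 1) / A)
  rw [div_le_iff₀' hA0] at hJ
  set m₀ : ℝ := max 1 (max (Real.log 2 / A) (8 * (b : ℝ) ^ J / β ^ 2)) with hm₀
  set D : ℝ := max (3 / A) (12 / β ^ 2) with hD
  have hL := tendsto_lnN hb
  refine aas_of_le (f := fun H => 4 * Real.exp (-lnN b H)) ?_ ?_
  · simpa using (Real.tendsto_exp_neg_atTop_nhds_zero.comp hL).const_mul 4
  filter_upwards [eventually_forall_rpow_lt hb hε m₀ D,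
    hL.eventually (eventually_ge_atTop 0)] with H hH hL0
  set L := lnN b H with hLdef
  set R := Finset.range (b ^ H + 1) with hR
  set R₁ := R.filter fun m : ℕ => 1 ≤ m ∧ Real.log 2 ≤ A * m ∧ 3 * L ≤ A * (m : ℝ) ^ 2 with hR₁
  set R₂ := R.filter fun s : ℕ => (b : ℝ) ^ J ≤ β / 4 * s ∧ 3 * L ≤ (s : ℝ) ^ 2 with hR₂
  have hsub : {ω : Leaf b H × Leaf b H → Bool | ¬ ¬ ∃ M : Finset (Leaf b H),
        IsInternallyDense (toDigraph ω) β M ∧ L ^ (1 / 2 + ε) < (M.card : ℝ)} ⊆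
      (⋃ m ∈ R₁, manyLongEdges b H β m) ∪ ⋃ s ∈ R₂, lowDenseSet b H β s := by
    intro ω hω
    simp only [Set.mem_ofPred_eq, not_not] at hω
    obtain ⟨M, hM, hlt⟩ := hω
    obtain ⟨hm, hmD⟩ := hH _ hlt
    have hMn : M.card ≤ b ^ H := (Finset.card_le_univ M).trans_eq (card_leaf b H)
    have h1 : (1 : ℝ) ≤ M.card := (le_max_left _ _).trans hm
    have h2 : Real.log 2 / A ≤ M.card :=
      ((le_max_left _ _).trans (le_max_right _ _)).trans hm
    have h3 : 8 * (b : ℝ) ^ J / β ^ 2 ≤ M.card :=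
      ((le_max_right _ _).trans (le_max_right _ _)).trans hm
    have h4 : 3 / A * L ≤ (M.card : ℝ) ^ 2 :=
      (mul_le_mul_of_nonneg_right (le_max_left _ _) hL0).trans hmD
    have h5 : 12 / β ^ 2 * L ≤ (M.card : ℝ) ^ 2 :=
      (mul_le_mul_of_nonneg_right (le_max_right _ _) hL0).trans hmD
    rw [div_le_iff₀ (by positivity)] at h2 h3
    rw [div_mul_eq_mul_div, div_le_iff₀ (by positivity)] at h4 h5
    have h1' : 1 ≤ M.card := by exact_mod_cast h1
    rcases hM.mem_manyLongEdges_or hβ (Finset.card_pos.1 h1') with hlong | ⟨s, hsm, hs, hlow⟩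
    · refine Or.inl (Set.mem_biUnion (Finset.mem_coe.2 (Finset.mem_filter.2
        ⟨Finset.mem_range.2 (by omega), h1', by linarith, by linarith⟩)) hlong)
    · refine Or.inr (Set.mem_biUnion (Finset.mem_coe.2 (Finset.mem_filter.2
        ⟨Finset.mem_range.2 (by omega), ?_, ?_⟩)) hlow)
      · have : β / 4 * (β / 2 * M.card) ≤ β / 4 * s := by gcongr
        linarith
      · have : (β / 2 * M.card) ^ 2 ≤ (s : ℝ) ^ 2 := by gcongr
        linarith
  have hRcard : (R.card : ℝ) ≤ 2 * Real.exp L := by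
    have h1 : (1 : ℝ) ≤ Real.exp L := Real.one_le_exp hL0
    rw [hR, Finset.card_range]
    push_cast
    rw [← exp_lnN hb]
    linarith
  have hsum {Q : Finset ℕ} (hQ : Q ⊆ R) {A : ℕ → Set (Leaf b H × Leaf b H → Bool)}
      (hA : ∀ k ∈ Q, (edgeLaw b c hc H).real (A k) ≤ Real.exp (-(2 * L))) :
      (edgeLaw b c hc H).real (⋃ k ∈ Q, A k) ≤ 2 * Real.exp (-L) := by
    refine (measureReal_biUnion_finset_le _ _).trans ((Finset.sum_le_card_nsmul _ _ _ hA).trans ?_)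
    rw [nsmul_eq_mul]
    calc (Q.card : ℝ) * Real.exp (-(2 * L)) ≤ 2 * Real.exp L * Real.exp (-(2 * L)) := by
          gcongr
          exact le_trans (by exact_mod_cast Finset.card_le_card hQ) hRcard
      _ = 2 * Real.exp (-L) := by
          rw [mul_assoc, ← Real.exp_add]
          ring_nf
  refine (measureReal_mono hsub (measure_ne_top _ _)).trans ((measureReal_union_le _ _).trans ?_)
  have hlong := hsum (Finset.filter_subset _ _ : R₁ ⊆ R) (A := manyLongEdges b H β) fun m hm => by
    obtain ⟨-, h1, h2, h3⟩ := Finset.mem_filter.1 hm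
    exact measureReal_manyLongEdges_le_exp hb h1 h2 h3
  have hlow := hsum (Finset.filter_subset _ _ : R₂ ⊆ R) (A := lowDenseSet b H β) fun s hs => by
    obtain ⟨-, h1, h2⟩ := Finset.mem_filter.1 hs
    exact measureReal_lowDenseSet_le_exp hb hβ hJ h1 h2
  linarith

end Asymptotic

end CGA

theorem theorem2 (b : ℕ) (hb : 2 ≤ b) (c : ℝ) (hc : 1 < c)
    (α : ℝ) (hα0 : 0 < α) (hα1 : α ≤ 1) :
    ∃ γ : ℝ, 0 < γ ∧ ∀ β : ℝ, 0 < β → β ≤ 1 → ∀ ε : ℝ, 0 < ε →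
      -- existence of clusters with more than `(ln n) ^ (1/2 - ε)` vertices
      (CGA.AAS b c hc fun H G =>
        ∃ M : Finset (CGA.Leaf b H), CGA.IsCluster G α β M ∧
          CGA.lnN b H ^ (1 / 2 - ε) < (M.card : ℝ)) ∧
      -- many complete clusters of every admissible height, which may depend on `n`
      (∀ h : ℕ → ℕ,
        (∀ᶠ H : ℕ in Filter.atTop,
          Real.logb b (Real.log b / (α * Real.log c)) < (h H : ℝ) ∧
          (h H : ℝ) ≤ (1 / 2 - ε) * (Real.log (CGA.lnN b H) / Real.log b)) →
        CGA.AAS b c hc fun H G =>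
          CGA.lnN b H ^ (γ * (b : ℝ) ^ h H) ≤ (CGA.numCompleteClusters G α β (h H) : ℝ)) ∧
      -- no clusters with more than `(ln n) ^ (1/2 + ε)` vertices
      (CGA.AAS b c hc fun H G =>
        ¬ ∃ M : Finset (CGA.Leaf b H), CGA.IsCluster G α β M ∧
          CGA.lnN b H ^ (1 / 2 + ε) < (M.card : ℝ)) := by
  refine ⟨1, one_pos, fun β hβ0 hβ1 ε hε => ⟨?_, fun h hh => ?_, ?_⟩⟩
  · exact CGA.aas_exists_isCluster hb hc hα0 hβ1 hε
  · simpa only [one_mul] using CGA.aas_numCompleteClusters hb hc hα0 hβ1 hε hh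
  · refine (CGA.aas_not_exists_isInternallyDense (hc := hc) hb hβ0 hε).mono
      (Filter.Eventually.of_forall fun H G hG => ?_)
    rintro ⟨M, hM, hlt⟩
    exact hG ⟨M, hM.1, hlt⟩
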